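/- Let $G=(V,\vec E,b)$ be a directed weighted graph: $V$ is a countably infinite set, $b:V\times V\to[0,\infty)$ satisfies $b(x,x)=0$, $\vec E=\{(x,y): b(x,y)>0\}$, and $m:V\to(0,\infty)$ is a measure on $V$. Assume that $G$ is locally finite (every $x$ has only finitely many $y$ with $b(x,y)>0$ or $b(y,x)>0$), that its underlying undirected graph is connected, and that for every $x\in V$ $$\beta^+(x):=\sum_{y}b(x,y)>0,\qquad \beta^-(x):=\sum_y b(y,x)>0,\qquad \beta^+(x)=\beta^-(x).$$ Let $\ell^2(V,m)$ be the Hilbert space of all $f:V\to\mathbb C$ with $\sum_x m(x)|f(x)|^2<\infty$, with scalar product $(f,g)_m=\sum_x m(x)f(x)\overline{g(x)}$, and let $\Delta$ be the operator with domain the finitely supported functions given by $$\Delta f(x)=\frac1{m(x)}\sum_{y\in V}b(x,y)\bigl(f(x)-f(y)\bigr).$$ It is closable; let $\overline\Delta$ be its closure. For $\Omega\subset V$ set $$m_\Omega=\inf_{x\in\Omega}\frac{\beta^+(x)}{m(x)},\qquad \tilde h(\Omega)=\inf_{\emptyset\ne U\subset\Omega,\ U\text{ finite}}\ \frac{\sum_{(x,y)\in\partial_EU}b(x,y)}{\sum_{x\in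 U}\beta^+(x)},$$ where $\partial_EU$ is the set of $(x,y)\in\vec E$ with exactly one of $x,y$ in $U$. Let $V_0\subset V_1\subset\cdots$ be finite subsets of $V$ with union $V$, each inducing a subgraph whose underlying undirected graph is connected, and put $m_\infty=\lim_{n}m_{V\setminus V_n}$ and $\tilde h_\infty=\lim_n\tilde h(V\setminus V_n)$ (monotone limits in $[0,\infty]$). If $G$ has heavy ends, i.e. $m_\infty=\infty$, and $\tilde h_\infty>0$, then the essential spectrum of $\overline\Delta$ is empty; here $\sigma_{ess}(A)$ is the set of all $\lambda\in\mathbb C$ such that the range of $A-\lambda$ is not closed or $\dim\ker(A-\lambda)=\infty$. In other words, for every $\lambda\in\mathbb C$ the operator $\overline\Delta-\lambda$ has closed range and finite-dimensional kernel. -/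

import Mathlib

open Filter Topology
open scoped NNReal ENNReal ComplexConjugate

noncomputable section

/-- A locally finite, loopless directed weighted graph on the vertex set `V`: edge weights
`b : V × V → [0, ∞)` vanishing on the diagonal, and a positive vertex measure `m`.
The directed edges are the pairs `(x, y)` with `b x y > 0`. -/
structure DiWGraph (V : Type*) where
  b : V → V → ℝ≥0
  m : V → ℝ≥0
  b_self : ∀ x, b x x = 0
  m_pos : ∀ x, 0 < m x
  locallyFinite : ∀ x, {y | 0 < b x y ∨ 0 < b y x}.Finite

namespace DiWGraph

variable {V : Type*} (G : DiWGraph V)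

/-- The set of directed edges. -/
def dirEdges : Set (V × V) := {p | 0 < G.b p.1 p.2}

/-- The underlying undirected graph, with edges `{x, y}` for `(x, y)` or `(y, x)` a directed
edge. -/
def undirected : SimpleGraph V where
  Adj x y := 0 < G.b x y ∨ 0 < G.b y x
  symm := ⟨fun _ _ h => h.symm⟩
  loopless := ⟨fun x h => by simp [G.b_self] at h⟩

/-- `β⁺(x) = ∑_y b(x, y)` (a finite sum, by local finiteness). -/
def betaOut (x : V) : ℝ≥0 := ∑' y, G.b x y

/-- `β⁻(x) = ∑_y b(y, x)` (a finite sum, by local finiteness). -/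
def betaIn (x : V) : ℝ≥0 := ∑' y, G.b y x

/-- The Kirchhoff assumption `β⁺ = β⁻`. -/
def Kirchhoff : Prop := ∀ x, G.betaOut x = G.betaIn x

/-! ### The Hilbert space `ℓ²(V, m)` -/

/-- The complex line over the vertex `x`, with the scalar product `(z, w) = m(x) z w̄`.
It is `ℂ` as a vector space. -/
def Fiber (_ : DiWGraph V) (_ : V) : Type := ℂ

instance (x : V) : AddCommGroup (G.Fiber x) := inferInstanceAs (AddCommGroup ℂ)

instance (x : V) : Module ℂ (G.Fiber x) := inferInstanceAs (Module ℂ ℂ)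

/-- The element of `G.Fiber x` given by a complex number. -/
def toFiber (x : V) (z : ℂ) : G.Fiber x := z

/-- The complex number underlying an element of `G.Fiber x`. -/
def ofFiber (x : V) (z : G.Fiber x) : ℂ := z

/-- Mathlib's `inner` is linear in the second variable, so this is `(w, z) = m(x) w z̄`. -/
@[reducible] def fiberCore (x : V) : InnerProductSpace.Core ℂ (G.Fiber x) where
  inner z w := ((G.m x : ℝ) : ℂ) * (G.ofFiber x w * conj (G.ofFiber x z))
  conj_inner_symm z w := by simp [mul_comm]
  re_inner_nonneg z := by
    rw [Complex.mul_conj]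
    simp only [← Complex.ofReal_mul, RCLike.re_to_complex, Complex.ofReal_re]
    exact mul_nonneg (G.m x).2 (Complex.normSq_nonneg _)
  add_left z w u := by
    change _ * (_ * conj (G.ofFiber x z + G.ofFiber x w)) = _
    rw [map_add]; ring
  smul_left z w r := by
    change _ * (_ * conj (r * G.ofFiber x z)) = _
    rw [map_mul]; ring
  definite z h := by
    have hm : ((G.m x : ℝ) : ℂ) ≠ 0 := by
      exact_mod_cast (G.m_pos x).ne'
    have h' := (mul_eq_zero.1 h).resolve_left hm
    rw [Complex.mul_conj] at h'
    exact Complex.normSq_eq_zero.1 (by exact_mod_cast h')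

instance (x : V) : NormedAddCommGroup (G.Fiber x) := (G.fiberCore x).toNormedAddCommGroup

instance (x : V) : InnerProductSpace ℂ (G.Fiber x) := InnerProductSpace.ofCore (G.fiberCore x).toCore

theorem fiber_inner (x : V) (z w : G.Fiber x) :
    inner ℂ z w = (G.m x : ℂ) * (G.ofFiber x w * conj (G.ofFiber x z)) := rfl

theorem fiber_norm_sq (x : V) (z : G.Fiber x) :
    ‖z‖ ^ 2 = (G.m x : ℝ) * ‖G.ofFiber x z‖ ^ 2 := by
  have h := inner_self_eq_norm_sq_to_K (𝕜 := ℂ) z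
  rw [fiber_inner, Complex.mul_conj, Complex.normSq_eq_norm_sq] at h
  have h' : ((‖z‖ ^ 2 : ℝ) : ℂ) = (((G.m x : ℝ) * ‖G.ofFiber x z‖ ^ 2 : ℝ) : ℂ) := by
    rw [Complex.ofReal_mul, Complex.ofReal_pow]
    exact h.symm
  exact Complex.ofReal_injective h'

/-- The Hilbert space `ℓ²(V, m)` of functions `f : V → ℂ` with `∑ m(x) |f(x)|² < ∞`. -/
abbrev L2 : Type _ := lp G.Fiber 2

/-- The function `V → ℂ` underlying an element of `ℓ²(V, m)`. -/
def fn (f : G.L2) (x : V) : ℂ := G.ofFiber x (f x)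

theorem memL2_iff (f : V → ℂ) :
    Memℓp (fun x => G.toFiber x (f x)) 2 ↔ Summable fun x => (G.m x : ℝ) * ‖f x‖ ^ 2 := by
  rw [memℓp_gen_iff (by norm_num)]
  refine summable_congr fun x => ?_
  rw [ENNReal.toReal_ofNat, Real.rpow_ofNat]
  exact G.fiber_norm_sq x (G.toFiber x (f x))

theorem L2_inner (f g : G.L2) :
    inner ℂ f g = ∑' x, (G.m x : ℂ) * (G.fn g x * conj (G.fn f x)) := rfl

theorem L2_norm_sq (f : G.L2) : ‖f‖ ^ 2 = ∑' x, (G.m x : ℝ) * ‖G.fn f x‖ ^ 2 := by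
  have h := lp.norm_rpow_eq_tsum (p := 2) (by norm_num) f
  simp only [ENNReal.toReal_ofNat, Real.rpow_ofNat] at h
  rw [h]
  exact tsum_congr fun x => G.fiber_norm_sq x (f x)

/-- The finitely supported functions, as a subspace of `ℓ²(V, m)`. -/
def finSupp : Submodule ℂ G.L2 where
  carrier := {f | (Function.support (G.fn f)).Finite}
  zero_mem' := by
    have : Function.support (G.fn 0) = ∅ := by
      ext x; simp only [Function.mem_support, Set.mem_empty_iff_false, iff_false, not_not]; rfl
    simp [this]
  add_mem' {f g} hf hg :=
    (hf.union hg).subset (Function.support_add (G.fn f) (G.fn g))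
  smul_mem' c f hf :=
    hf.subset (Function.support_const_smul_subset c (G.fn f))

/-! ### The Laplacian -/

/-- `Δf(x) = (1 / m(x)) ∑_y b(x, y) (f(x) - f(y))`. -/
def lapFn (f : V → ℂ) (x : V) : ℂ :=
  1 / (G.m x : ℂ) * ∑' y, (G.b x y : ℂ) * (f x - f y)

theorem lap_term_support (f : V → ℂ) (x : V) :
    (Function.support fun y => (G.b x y : ℂ) * (f x - f y)).Finite := by
  refine (G.locallyFinite x).subset fun y hy => Or.inl ?_
  rw [Function.mem_support] at hy
  exact pos_iff_ne_zero.2 fun h => hy (by simp [h])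

theorem lapFn_add (f g : V → ℂ) (x : V) :
    G.lapFn (f + g) x = G.lapFn f x + G.lapFn g x := by
  unfold lapFn
  rw [← mul_add, ← Summable.tsum_add (summable_of_hasFiniteSupport (G.lap_term_support f x))
    (summable_of_hasFiniteSupport (G.lap_term_support g x))]
  congr 1
  refine tsum_congr fun y => ?_
  simp only [Pi.add_apply]; ring

theorem lapFn_smul (c : ℂ) (f : V → ℂ) (x : V) :
    G.lapFn (c • f) x = c * G.lapFn f x := by
  unfold lapFn
  rw [mul_left_comm c, ← tsum_mul_left (a := c)]
  congr 1
  refine tsum_congr fun y => ?_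
  simp only [Pi.smul_apply, smul_eq_mul]; ring

theorem lapFn_support_finite (f : V → ℂ) (hf : (Function.support f).Finite) :
    (Function.support (G.lapFn f)).Finite := by
  refine (hf.union (hf.biUnion fun y _ => G.locallyFinite y)).subset fun x hx => ?_
  by_contra hcon
  rw [Set.mem_union, not_or] at hcon
  obtain ⟨h1, h2⟩ := hcon
  refine hx ?_
  have hz : ∀ y, (G.b x y : ℂ) * (f x - f y) = 0 := by
    intro y
    by_cases hy : f y = 0
    · simp [Function.notMem_support.1 h1, hy]
    · have hb : G.b x y = 0 := by
        by_contra hb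
        exact h2 (Set.mem_biUnion (x := y) hy (Or.inr (pos_iff_ne_zero.2 hb)))
      simp [hb]
  simp [lapFn, hz]

theorem lapFn_memL2 (f : V → ℂ) (hf : (Function.support f).Finite) :
    Memℓp (fun x => G.toFiber x (G.lapFn f x)) 2 := by
  rw [memL2_iff]
  refine summable_of_hasFiniteSupport ((G.lapFn_support_finite f hf).subset fun x hx => ?_)
  rw [Function.mem_support] at hx ⊢
  exact fun h => hx (by simp [h])

/-- The Laplacian `Δ` as an (in general unbounded) operator in `ℓ²(V, m)`, with domain the
finitely supported functions. -/
def laplacian : G.L2 →ₗ.[ℂ] G.L2 where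
  domain := G.finSupp
  toFun :=
    { toFun := fun f => ⟨fun x => G.toFiber x (G.lapFn (G.fn f.1) x), G.lapFn_memL2 _ f.2⟩
      map_add' := fun f g => lp.ext (funext fun x => G.lapFn_add (G.fn f.1) (G.fn g.1) x)
      map_smul' := fun c f => lp.ext (funext fun x => G.lapFn_smul c (G.fn f.1) x) }

theorem continuous_fn (x : V) : Continuous fun f : G.L2 => G.fn f x := by
  let L : G.Fiber x →ₗ[ℂ] ℂ :=
    { toFun := G.ofFiber x, map_add' := fun _ _ => rfl, map_smul' := fun _ _ => rfl }
  have : FiniteDimensional ℂ (G.Fiber x) := inferInstanceAs (FiniteDimensional ℂ ℂ)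
  exact L.continuous_of_finiteDimensional.comp (lp.evalCLM ℂ G.Fiber 2 x).continuous

/-- The Laplacian is closable, so that `G.laplacian.closure` is its closure `Δ̄`. -/
theorem laplacian_isClosable : G.laplacian.IsClosable := by
  have key : ∀ p ∈ G.laplacian.graph.topologicalClosure, ∀ x,
      G.fn p.2 x = G.lapFn (G.fn p.1) x := by
    intro p hp x
    have hcl : IsClosed {p : G.L2 × G.L2 | G.fn p.2 x = G.lapFn (G.fn p.1) x} := by
      refine isClosed_eq ((G.continuous_fn x).comp continuous_snd) ?_
      have hs : ∀ f : V → ℂ, G.lapFn f x = 1 / (G.m x : ℂ) *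
          ∑ y ∈ (G.locallyFinite x).toFinset, (G.b x y : ℂ) * (f x - f y) := by
        intro f
        unfold lapFn
        rw [tsum_eq_sum]
        intro y hy
        have : G.b x y = 0 := by
          by_contra h
          exact hy ((Set.Finite.mem_toFinset _).2 (Or.inl (pos_iff_ne_zero.2 h)))
        simp [this]
      simp only [hs]
      have h1 := fun y => (G.continuous_fn y).comp (continuous_fst (X := G.L2) (Y := G.L2))
      refine continuous_const.mul (continuous_finsetSum _ fun y _ =>
        continuous_const.mul ((h1 x).sub (h1 y)))
    have hsub : (G.laplacian.graph : Set (G.L2 × G.L2)) ⊆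
        {p : G.L2 × G.L2 | G.fn p.2 x = G.lapFn (G.fn p.1) x} := by
      intro q hq
      obtain ⟨f, hf1, hf2⟩ := (LinearPMap.mem_graph_iff _).1 hq
      change G.fn q.2 x = G.lapFn (G.fn q.1) x
      rw [← hf1, ← hf2]; rfl
    exact closure_minimal hsub hcl hp
  refine ⟨G.laplacian.graph.topologicalClosure.toLinearPMap, ?_⟩
  rw [Submodule.toLinearPMap_graph_eq]
  intro p hp h0
  refine lp.ext (funext fun x => ?_)
  have := key p hp x
  rw [h0] at this
  have hz : G.lapFn (G.fn 0) x = 0 := by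
    have : ∀ y, G.fn (0 : G.L2) y = 0 := fun _ => rfl
    simp [lapFn, this]
  exact this.trans hz

/-! ### Isoperimetric constants -/

/-- The edge boundary: the directed edges joining `U` to its complement, in either direction. -/
def edgeBoundary (U : Set V) : Set (V × V) :=
  {p | p ∈ G.dirEdges ∧ ((p.1 ∈ U ∧ p.2 ∉ U) ∨ (p.1 ∉ U ∧ p.2 ∈ U))}

/-- The total weight of the edge boundary. -/
def boundaryWeight (U : Set V) : ℝ≥0∞ := ∑' p : G.edgeBoundary U, (G.b p.1.1 p.1.2 : ℝ≥0∞)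

/-- `h̃(Ω)`, the infimum of `b(∂_E U) / β⁺(U)` over the nonempty finite `U ⊆ Ω`. -/
def normCheeger (Ω : Set V) : ℝ≥0∞ :=
  ⨅ (U : Finset V) (_ : U.Nonempty) (_ : (U : Set V) ⊆ Ω),
    G.boundaryWeight U / ∑ x ∈ U, (G.betaOut x : ℝ≥0∞)

/-- `m_Ω = inf {β⁺(x) / m(x) : x ∈ Ω}`. -/
def minRatio (Ω : Set V) : ℝ≥0∞ := ⨅ x ∈ Ω, (G.betaOut x : ℝ≥0∞) / (G.m x : ℝ≥0∞)

theorem normCheeger_anti : Antitone G.normCheeger := fun _ _ h =>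
  le_iInf fun U => le_iInf fun hU => le_iInf fun hs =>
    iInf_le_of_le U (iInf_le_of_le hU (iInf_le_of_le (hs.trans h) le_rfl))

theorem minRatio_anti : Antitone G.minRatio := fun _ _ h =>
  biInf_mono fun _ hx => h hx

/-- A filtration: an increasing sequence of finite connected induced subgraphs exhausting the
graph, given by their vertex sets. -/
structure Filtration where
  verts : ℕ → Finset V
  connected : ∀ n, (G.undirected.induce (verts n : Set V)).Connected
  subset_succ : ∀ n, verts n ⊆ verts (n + 1)
  exhaust : ∀ x, ∃ n, x ∈ verts n

variable {G}

/-- `m_∞ = lim m_{V_n^c}`. -/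
def Filtration.minRatioInfty (F : G.Filtration) : ℝ≥0∞ :=
  limUnder atTop fun n => G.minRatio ((F.verts n : Set V)ᶜ)

/-- `h̃_∞ = lim h̃(V_n^c)`. -/
def Filtration.normCheegerInfty (F : G.Filtration) : ℝ≥0∞ :=
  limUnder atTop fun n => G.normCheeger ((F.verts n : Set V)ᶜ)

/-- The graph has heavy ends: `m_∞ = ∞`. -/
def Filtration.HeavyEnds (F : G.Filtration) : Prop := F.minRatioInfty = ⊤

theorem Filtration.compl_antitone (F : G.Filtration) :
    Antitone fun n => ((F.verts n : Set V)ᶜ) := fun _ _ h =>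
  Set.compl_subset_compl.2 (Finset.coe_subset.2 (monotone_nat_of_le_succ F.subset_succ h))

/-- The limit defining `m_∞` exists. -/
theorem Filtration.tendsto_minRatioInfty (F : G.Filtration) :
    Tendsto (fun n => G.minRatio ((F.verts n : Set V)ᶜ)) atTop (𝓝 F.minRatioInfty) :=
  tendsto_nhds_limUnder ⟨_, tendsto_atTop_iSup fun _ _ h => G.minRatio_anti (F.compl_antitone h)⟩

/-- The limit defining `h̃_∞` exists. -/
theorem Filtration.tendsto_normCheegerInfty (F : G.Filtration) :
    Tendsto (fun n => G.normCheeger ((F.verts n : Set V)ᶜ)) atTop (𝓝 F.normCheegerInfty) :=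
  tendsto_nhds_limUnder ⟨_, tendsto_atTop_iSup fun _ _ h => G.normCheeger_anti (F.compl_antitone h)⟩

end DiWGraph

/-- The essential spectrum of an operator `A` in a Hilbert space: the `z : ℂ` for which the range
of `A - z` is not closed or the kernel of `A - z` is infinite-dimensional. -/
def LinearPMap.essSpectrum {H : Type*} [NormedAddCommGroup H] [InnerProductSpace ℂ H]
    (A : H →ₗ.[ℂ] H) : Set ℂ :=
  {z | ¬ _root_.IsClosed (LinearMap.range (A.toFun - z • A.domain.subtype) : Set H) ∨
    ¬ FiniteDimensional ℂ (LinearMap.ker (A.toFun - z • A.domain.subtype))}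

end

/-! Fix `z`. By Kirchhoff, the real part of `(Δf, f)` is half the energy `∑ b(x,y)|f(x) - f(y)|²`.
If `f` is finitely supported off `V_n`, Cheeger's inequality (`cheeger_inequality`) bounds this
below by `h²/8 · ∑ β⁺|f|²` whenever `0 < h ≤ h̃(V ∖ V_n)`, and `β⁺ ≥ C m` off `V_n` turns that into
`(h²/8) C ‖f‖²`. Since `h̃_∞ > 0`, one `h` serves all large `n`, while heavy ends allow any `C`;
with `(h²/8) C = |z| + 1`, Cauchy-Schwarz gives `‖f‖ ≤ ‖(Δ - z) f‖`.

Vanishing on `V_n` is finitely many linear conditions, and the indicators of the vertices of `V_n`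
span a complement inside the domain. Hence `Δ̄ - z` is bounded below on a closed subspace of finite
codimension in its graph, which forces closed range and finite-dimensional kernel
(`notMem_essSpectrum_closure`). -/

namespace LinearPMap

/-! ### Closures of operators bounded below in finite codimension -/

variable {H : Type*} [NormedAddCommGroup H] [InnerProductSpace ℂ H]

/-- The bounded map `(u, v) ↦ v - z u`, which computes `A u - z u` on the graph of `A`. -/
noncomputable def subSmulCLM (H : Type*) [NormedAddCommGroup H] [InnerProductSpace ℂ H] (z : ℂ) :
    H × H →L[ℂ] H :=
  ContinuousLinearMap.snd ℂ H H - z • ContinuousLinearMap.fst ℂ H H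

@[simp]
theorem subSmulCLM_apply (z : ℂ) (p : H × H) : subSmulCLM H z p = p.2 - z • p.1 := rfl

/-- Moves the closed-range question to a bounded map on the graph, which is a closed subspace when
the operator is closed. -/
theorem range_sub_smul_eq_map_graph (A : H →ₗ.[ℂ] H) (z : ℂ) :
    LinearMap.range (A.toFun - z • A.domain.subtype) =
      A.graph.map (subSmulCLM H z : H × H →ₗ[ℂ] H) := by
  ext w
  constructor
  · rintro ⟨f, rfl⟩
    exact ⟨_, A.mem_graph f, rfl⟩
  · rintro ⟨p, hp, rfl⟩
    obtain ⟨f, hf1, hf2⟩ := (mem_graph_iff _).1 hp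
    refine ⟨f, ?_⟩
    change A f - z • (f : H) = p.2 - z • p.1
    rw [hf1, hf2]

/-- A lower bound for `A - z` on a subspace of finite codimension, complemented inside the
domain, passes to the graph of the closure. -/
theorem bound_of_mem_closure_graph {A : H →ₗ.[ℂ] H} (hA : A.IsClosable) {ι : Type*} [Fintype ι]
    [DecidableEq ι] (e : ι → A.domain) (c : ι → H →L[ℂ] ℂ)
    (hce : ∀ i j, c i (e j) = if i = j then 1 else 0) (z : ℂ)
    (hb : ∀ f : A.domain, (∀ i, c i f = 0) → ‖(f : H)‖ ≤ ‖A f - z • (f : H)‖)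
    {p : H × H} (hp : p ∈ A.closure.graph) (hcp : ∀ i, c i p.1 = 0) :
    ‖p.1‖ ≤ ‖p.2 - z • p.1‖ := by
  -- Graph points approximating `p` need not satisfy the constraints `c i = 0`. The continuous
  -- projection `Φ` along the `(e i, A (e i))` enforces them, preserves the graph and fixes `p`.
  let Φ : H × H → H × H := fun q =>
    (q.1 - ∑ i, c i q.1 • (e i : H), q.2 - ∑ i, c i q.1 • A (e i))
  have hΦ : Continuous Φ := by fun_prop
  have hcl : _root_.IsClosed {q : H × H | ‖(Φ q).1‖ ≤ ‖(Φ q).2 - z • (Φ q).1‖} :=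
    isClosed_le (by fun_prop) (by fun_prop)
  have hsub : (A.graph : Set (H × H)) ⊆ {q : H × H | ‖(Φ q).1‖ ≤ ‖(Φ q).2 - z • (Φ q).1‖} := by
    intro q hq
    obtain ⟨f, hf1, hf2⟩ := (mem_graph_iff _).1 hq
    let g : A.domain := f - ∑ i, c i f • e i
    have hg : (g : H) = (Φ q).1 := by simp [g, Φ, hf1]
    have hAg : A g = (Φ q).2 := by
      simp only [g, Φ, ← hf1, ← hf2]
      refine (LinearPMap.map_sub A _ _).trans (congrArg _ ?_)
      refine (_root_.map_sum A.toFun _ _).trans (Finset.sum_congr rfl fun i _ => ?_)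
      exact LinearPMap.map_smul A _ _
    change ‖(Φ q).1‖ ≤ ‖(Φ q).2 - z • (Φ q).1‖
    rw [← hg, ← hAg]
    refine hb g fun i => ?_
    simp [g, hce]
  have hmem : p ∈ (A.graph.topologicalClosure : Set (H × H)) := by
    rw [hA.graph_closure_eq_closure_graph]; exact hp
  have h := closure_minimal hsub hcl hmem
  simpa [Φ, hcp] using h

/-- If `A - z` is bounded below on the common kernel of finitely many functionals which have a
dual system in the domain of `A`, then `z` is not in the essential spectrum of the closure. -/
theorem notMem_essSpectrum_closure [CompleteSpace H] {A : H →ₗ.[ℂ] H} (hA : A.IsClosable)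
    {ι : Type*} [Fintype ι] [DecidableEq ι] (e : ι → A.domain) (c : ι → H →L[ℂ] ℂ)
    (hce : ∀ i j, c i (e j) = if i = j then 1 else 0) (z : ℂ)
    (hb : ∀ f : A.domain, (∀ i, c i f = 0) → ‖(f : H)‖ ≤ ‖A f - z • (f : H)‖) :
    z ∉ A.closure.essSpectrum := by
  have key := fun {p : H × H} => bound_of_mem_closure_graph hA e c hce z hb (p := p)
  simp only [essSpectrum, Set.mem_ofPred_eq, not_or, not_not]
  constructor
  · let K : Submodule ℂ (H × H) := ⨅ i, LinearMap.ker ((c i : H →ₗ[ℂ] ℂ) ∘ₗ LinearMap.fst ℂ H H)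
    have hK : ∀ p, p ∈ K ↔ ∀ i, c i p.1 = 0 := fun p => by simp [K]
    have hKcl : _root_.IsClosed (K : Set (H × H)) := by
      have : (K : Set (H × H)) = ⋂ i, {p : H × H | c i p.1 = 0} := by
        ext p; simp [hK]
      rw [this]
      exact isClosed_iInter fun i => isClosed_eq (by fun_prop) (by fun_prop)
    let S : Submodule ℂ (H × H) := Submodule.span ℂ (Set.range fun i => ((e i : H), A (e i)))
    have : FiniteDimensional ℂ S := FiniteDimensional.span_of_finite ℂ (Set.finite_range _)
    have hS : S ≤ A.closure.graph := by
      refine Submodule.span_le.2 ?_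
      rintro _ ⟨i, rfl⟩
      exact le_graph_of_le A.le_closure (A.mem_graph (e i))
    -- Subtracting `∑ c i · (e i, A (e i))` splits the graph into a part on which `A - z` is bounded
    -- below and a finite-dimensional part, whose image cannot spoil closedness.
    have hdec : A.closure.graph = (A.closure.graph ⊓ K) ⊔ S := by
      refine le_antisymm (fun p hp => ?_) (sup_le inf_le_left hS)
      have hs : ∑ i, c i p.1 • ((e i : H), A (e i)) ∈ S :=
        Submodule.sum_mem _ fun i _ => S.smul_mem _ (Submodule.subset_span ⟨i, rfl⟩)
      refine Submodule.mem_sup.2 ⟨p - ∑ i, c i p.1 • ((e i : H), A (e i)), ?_, _, hs,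
        sub_add_cancel _ _⟩
      refine ⟨Submodule.sub_mem _ hp (hS hs), (hK _).2 fun i => ?_⟩
      simp [Prod.fst_sum, hce]
    have hGcl : _root_.IsClosed ((A.closure.graph ⊓ K : Submodule ℂ (H × H)) : Set (H × H)) :=
      hA.closure_isClosed.inter hKcl
    rw [range_sub_smul_eq_map_graph, hdec, Submodule.map_sup]
    refine Submodule.isClosed_sup_finiteDimensional _ _ ?_
    let τ := (subSmulCLM H z).comp (A.closure.graph ⊓ K).subtypeL
    -- The bound controls `p.1`, and `p.2 = (p.2 - z p.1) + z p.1` then controls `p.2`: hence `1 +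
    -- |z|` in the max norm.
    have hτ : AntilipschitzWith (1 + ‖z‖₊) τ := by
      refine ContinuousLinearMap.antilipschitz_of_bound _ fun p => ?_
      have h1 := key p.2.1 ((hK _).1 p.2.2)
      have h2 : ‖p.1.2‖ ≤ ‖p.1.2 - z • p.1.1‖ + ‖z‖ * ‖p.1.1‖ := by
        rw [← norm_smul]
        simpa using norm_add_le (p.1.2 - z • p.1.1) (z • p.1.1)
      have h3 : ‖τ p‖ = ‖p.1.2 - z • p.1.1‖ := rfl
      have h4 := mul_le_mul_of_nonneg_left h1 (norm_nonneg z)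
      rw [h3]
      change max ‖p.1.1‖ ‖p.1.2‖ ≤ (1 + ‖z‖) * _
      have h5 := mul_nonneg (norm_nonneg z) (norm_nonneg (p.1.2 - z • p.1.1))
      refine max_le ?_ ?_ <;> linarith
    have : CompleteSpace (A.closure.graph ⊓ K : Submodule ℂ (H × H)) :=
      hGcl.completeSpace_coe
    have hr := hτ.isClosed_range τ.uniformContinuous
    convert hr using 1
    ext w
    simp [τ]
  -- A kernel vector killed by all `c i` has norm at most `0`, so the kernel embeds in a finite
  -- power of `ℂ`.
  · let κ := LinearMap.pi (fun i => (c i : H →ₗ[ℂ] ℂ) ∘ₗ A.closure.domain.subtype ∘ₗ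
      (LinearMap.ker (A.closure.toFun - z • A.closure.domain.subtype)).subtype)
    refine FiniteDimensional.of_injective κ ?_
    rw [injective_iff_map_eq_zero]
    intro f hf
    have h0 : A.closure f.1 - z • (f.1 : H) = 0 := f.2
    have h := key (A.closure.mem_graph f.1) fun i => congrFun hf i
    rw [h0, norm_zero, norm_le_zero_iff] at h
    exact Subtype.ext (Subtype.ext h)

end LinearPMap

/-! ### Co-area and Cheeger inequalities on finite sets -/

/-- A discrete co-area inequality: an isoperimetric inequality for the nonempty subsets of `A`
implies an inequality for the nonnegative functions supported in `A`. -/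
theorem isoperimetric_mul_sum_le_sum_abs_sub {V : Type*} [DecidableEq V] (S : Finset V)
    (b : V → V → ℝ) (β : V → ℝ) (h : ℝ) (A : Finset V)
    (hA : ∀ U ⊆ A, U.Nonempty → h * ∑ x ∈ U, β x ≤
      ∑ x ∈ S, ∑ y ∈ S, b x y * |(if x ∈ U then 1 else 0) - (if y ∈ U then 1 else 0)|)
    (g : V → ℝ) (hg : ∀ x, 0 ≤ g x) (hgA : ∀ x, x ∉ A → g x = 0) :
    h * ∑ x ∈ A, β x * g x ≤ ∑ x ∈ S, ∑ y ∈ S, b x y * |g x - g y| := by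
  induction hn : (A.filter fun x => g x ≠ 0).card using Nat.strong_induction_on generalizing g with
  | _ n ih =>
  set U := A.filter fun x => g x ≠ 0 with hU
  have hUz : ∀ x, x ∉ U → g x = 0 := fun x hx => by
    by_contra hne
    exact hx (Finset.mem_filter.2 ⟨by_contra fun hxA => hne (hgA x hxA), hne⟩)
  rcases U.eq_empty_or_nonempty with hE | hne
  · have h0 : ∀ x, g x = 0 := fun x => hUz x (by simp [hE])
    simp [h0]
  obtain ⟨x₀, hx₀, hmin⟩ := U.exists_min_image g hne
  have hc : 0 < g x₀ := lt_of_le_of_ne (hg _) (Finset.mem_filter.1 hx₀).2.symm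
  -- Peel off the bottom layer, of height `min g` over the support `U`. The support shrinks by at
  -- least `x₀`, and both sides of the inequality are additive over the two layers.
  let g' : V → ℝ := fun x => g x - g x₀ * (if x ∈ U then 1 else 0)
  have hgU : ∀ x, x ∈ U → g x = g' x + g x₀ := fun x hx => by simp [g', hx]
  have hgU' : ∀ x, x ∉ U → g' x = 0 := fun x hx => by simp [g', hx, hUz x hx]
  have hg'0 : ∀ x, 0 ≤ g' x := fun x => by
    by_cases hx : x ∈ U
    · have := hmin x hx; have := hgU x hx; linarith
    · exact (hgU' x hx).ge
  have hcard : (A.filter fun x => g' x ≠ 0).card < n := by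
    rw [← hn]
    refine Finset.card_lt_card ⟨fun x hx => ?_, fun hs => ?_⟩
    · by_contra hxU
      exact (Finset.mem_filter.1 hx).2 (hgU' x hxU)
    · have := (Finset.mem_filter.1 (hs hx₀)).2
      exact this (by simp [g', hx₀])
  have hind := ih _ hcard g' hg'0
    (fun x hx => hgU' x fun hxU => hx (Finset.mem_filter.1 hxU).1) rfl
  have hiso := mul_le_mul_of_nonneg_left (hA U (Finset.filter_subset _ _) hne) hc.le
  have hL : ∑ x ∈ A, β x * g x = ∑ x ∈ A, β x * g' x + g x₀ * ∑ x ∈ U, β x := by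
    have h1 : ∑ x ∈ U, β x = ∑ x ∈ A, β x * (if x ∈ U then 1 else 0) := by
      simp only [mul_ite, mul_one, mul_zero, ← Finset.sum_filter]
      congr 1
      ext x
      simp [hU]
    rw [h1, Finset.mul_sum, ← Finset.sum_add_distrib]
    refine Finset.sum_congr rfl fun x _ => ?_
    simp only [g']; ring
  have hR : ∑ x ∈ S, ∑ y ∈ S, b x y * |g x - g y| =
      ∑ x ∈ S, ∑ y ∈ S, b x y * |g' x - g' y| + g x₀ * ∑ x ∈ S, ∑ y ∈ S,
        b x y * |(if x ∈ U then 1 else 0) - (if y ∈ U then 1 else 0)| := by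
    rw [Finset.mul_sum, ← Finset.sum_add_distrib]
    refine Finset.sum_congr rfl fun x _ => ?_
    rw [Finset.mul_sum, ← Finset.sum_add_distrib]
    refine Finset.sum_congr rfl fun y _ => ?_
    have hx0 := hg'0 x
    have hy0 := hg'0 y
    by_cases hx : x ∈ U <;> by_cases hy : y ∈ U
    · simp [hx, hy, hgU x hx, hgU y hy]
    · simp only [hx, hy, hgU x hx, hUz y hy, hgU' y hy, if_true, if_false, sub_zero, abs_one]
      rw [abs_of_nonneg (by linarith), abs_of_nonneg hx0]; ring
    · simp only [hx, hy, hgU y hy, hUz x hx, hgU' x hx, if_true, if_false, zero_sub, abs_neg,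
        abs_one]
      rw [abs_of_nonneg (by linarith), abs_of_nonneg hy0]; ring
    · simp [hx, hy, hUz x hx, hUz y hy, hgU' x hx, hgU' y hy]
  rw [hL, hR, mul_add]
  linarith

/-- Cheeger's inequality for a finite weighted directed graph with `∑_y b(x, y) = ∑_y b(y, x)`
on the support of `f`. -/
theorem cheeger_inequality {V : Type*} [DecidableEq V] (S A : Finset V) (hAS : A ⊆ S)
    (b : V → V → ℝ) (hb : ∀ x y, 0 ≤ b x y) (β : V → ℝ) {h : ℝ} (hh : 0 < h)
    (hout : ∀ x ∈ A, ∑ y ∈ S, b x y = β x) (hin : ∀ x ∈ A, ∑ y ∈ S, b y x = β x)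
    (hA : ∀ U ⊆ A, U.Nonempty → h * ∑ x ∈ U, β x ≤
      ∑ x ∈ S, ∑ y ∈ S, b x y * |(if x ∈ U then 1 else 0) - (if y ∈ U then 1 else 0)|)
    (f : V → ℂ) (hf : ∀ x, x ∉ A → f x = 0) :
    h ^ 2 / 8 * ∑ x ∈ A, β x * ‖f x‖ ^ 2 ≤
      ∑ x ∈ S, ∑ y ∈ S, b x y * ((f x - f y) * conj (f x)).re := by
  have hco := isoperimetric_mul_sum_le_sum_abs_sub S b β h A hA (fun x => ‖f x‖ ^ 2)
    (fun x => by positivity) (fun x hx => by simp [hf x hx])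
  set B := ∑ x ∈ A, β x * ‖f x‖ ^ 2 with hB
  have hsumA : ∀ F : V → ℝ, ∑ x ∈ S, F x * ‖f x‖ ^ 2 = ∑ x ∈ A, F x * ‖f x‖ ^ 2 := fun F =>
    (Finset.sum_subset hAS fun x _ hx => by simp [hf x hx]).symm
  have hB1 : ∑ x ∈ S, ∑ y ∈ S, b x y * ‖f x‖ ^ 2 = B := by
    simp only [← Finset.sum_mul]
    rw [hsumA]
    exact Finset.sum_congr rfl fun x hx => by rw [hout x hx]
  have hB2 : ∑ x ∈ S, ∑ y ∈ S, b x y * ‖f y‖ ^ 2 = B := by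
    rw [Finset.sum_comm]
    simp only [← Finset.sum_mul]
    rw [hsumA]
    exact Finset.sum_congr rfl fun x hx => by rw [hin x hx]
  set E := ∑ x ∈ S, ∑ y ∈ S, b x y * ‖f x - f y‖ ^ 2 with hE
  have hnorm : ∀ z : ℂ, ‖z‖ ^ 2 = z.re * z.re + z.im * z.im := fun z => by
    rw [← Complex.normSq_eq_norm_sq, Complex.normSq_apply]
  -- `Re((a - b) ā) = |a - b|²/2 + (|a|² - |b|²)/2`; the last term cancels in the sum because
  -- outgoing and incoming weights agree on `A`.
  have hQ : ∑ x ∈ S, ∑ y ∈ S, b x y * ((f x - f y) * conj (f x)).re =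
      1 / 2 * E + 1 / 2 * (B - B) := by
    nth_rewrite 1 [← hB1]
    rw [← hB2, hE]
    simp only [Finset.mul_sum, ← Finset.sum_sub_distrib, ← Finset.sum_add_distrib]
    refine Finset.sum_congr rfl fun x _ => Finset.sum_congr rfl fun y _ => ?_
    simp only [hnorm, Complex.mul_re, Complex.sub_re, Complex.sub_im, Complex.conj_re,
      Complex.conj_im]
    ring
  have hpt : ∑ x ∈ S, ∑ y ∈ S, b x y * |‖f x‖ ^ 2 - ‖f y‖ ^ 2| ≤
      2 / h * E + h / 4 * (B + B) := by
    nth_rewrite 1 [← hB1]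
    rw [← hB2, hE]
    simp only [Finset.mul_sum, ← Finset.sum_add_distrib]
    refine Finset.sum_le_sum fun x _ => Finset.sum_le_sum fun y _ => ?_
    have h1 : |‖f x‖ ^ 2 - ‖f y‖ ^ 2| ≤ ‖f x - f y‖ * (‖f x‖ + ‖f y‖) := by
      rw [sq_sub_sq, abs_mul, abs_of_nonneg (by positivity), mul_comm]
      exact mul_le_mul_of_nonneg_right (abs_norm_sub_norm_le _ _) (by positivity)
    -- Young's inequality weighted by `2 / h`, so that after summation the `B` terms total `h B /
    -- 2`, half of the left side, and can be absorbed.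
    have h2 : ‖f x - f y‖ * (‖f x‖ + ‖f y‖) ≤
        2 / h * ‖f x - f y‖ ^ 2 + h / 4 * (‖f x‖ ^ 2 + ‖f y‖ ^ 2) := by
      have h3 : 0 ≤ 2 / h * (‖f x - f y‖ - h / 4 * (‖f x‖ + ‖f y‖)) ^ 2 := by positivity
      have h4 : 2 / h * (‖f x - f y‖ - h / 4 * (‖f x‖ + ‖f y‖)) ^ 2 =
          2 / h * ‖f x - f y‖ ^ 2 - ‖f x - f y‖ * (‖f x‖ + ‖f y‖) +
            h / 8 * (‖f x‖ + ‖f y‖) ^ 2 := by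
        field_simp
        ring
      have h5 : 0 ≤ h / 8 * (‖f x‖ - ‖f y‖) ^ 2 := by positivity
      linarith
    calc b x y * |‖f x‖ ^ 2 - ‖f y‖ ^ 2| ≤ b x y * (2 / h * ‖f x - f y‖ ^ 2 +
          h / 4 * (‖f x‖ ^ 2 + ‖f y‖ ^ 2)) := mul_le_mul_of_nonneg_left (h1.trans h2) (hb x y)
      _ = _ := by ring
  rw [hQ]
  have h6 := hco.trans hpt
  have h7 : h * B / 2 ≤ 2 / h * E := by linarith
  have h8 := mul_le_mul_of_nonneg_left h7 (by positivity : 0 ≤ h / 4)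
  have h9 : h / 4 * (2 / h * E) = E / 2 := by field_simp; ring
  rw [h9] at h8
  linarith

/-! ### Cheeger's inequality for the graph Laplacian -/

namespace DiWGraph

variable {V : Type*} (G : DiWGraph V)

instance (x : V) : CompleteSpace (G.Fiber x) :=
  have : FiniteDimensional ℂ (G.Fiber x) := inferInstanceAs (FiniteDimensional ℂ ℂ)
  FiniteDimensional.complete ℂ _

/-- Evaluation at a vertex, as a bounded functional on `ℓ²(V, m)`. -/
noncomputable def coordCLM (x : V) : G.L2 →L[ℂ] ℂ where
  toFun f := G.fn f x
  map_add' _ _ := rfl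
  map_smul' _ _ := rfl
  cont := G.continuous_fn x

/-- The indicator function of a vertex, as an element of the domain of the Laplacian. -/
noncomputable def dirac [DecidableEq V] (x : V) : G.laplacian.domain :=
  ⟨lp.single 2 x (G.toFiber x 1), (Set.finite_singleton x).subset fun y hy => by
    by_contra hne
    exact hy (lp.single_apply_ne 2 x _ hne)⟩

theorem coordCLM_dirac [DecidableEq V] (x y : V) :
    G.coordCLM x (G.dirac y) = if x = y then 1 else 0 := by
  by_cases h : x = y
  · subst h
    rw [if_pos rfl]
    exact lp.single_apply_self 2 x _
  · rw [if_neg h]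
    exact lp.single_apply_ne 2 y _ h

/-- A finite set of vertices together with all its neighbours. -/
noncomputable def neighborhood [DecidableEq V] (A : Finset V) : Finset V :=
  A ∪ A.biUnion fun x => (G.locallyFinite x).toFinset

variable {G}

theorem subset_neighborhood [DecidableEq V] (A : Finset V) : A ⊆ G.neighborhood A :=
  Finset.subset_union_left

theorem mem_neighborhood [DecidableEq V] {A : Finset V} {x y : V} (hx : x ∈ A)
    (h : G.b x y ≠ 0 ∨ G.b y x ≠ 0) : y ∈ G.neighborhood A := by
  refine Finset.mem_union_right _ (Finset.mem_biUnion.2 ⟨x, hx, ?_⟩)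
  rw [Set.Finite.mem_toFinset]
  exact h.imp pos_iff_ne_zero.2 pos_iff_ne_zero.2

theorem sum_neighborhood_out [DecidableEq V] {A : Finset V} {x : V} (hx : x ∈ A) :
    ∑ y ∈ G.neighborhood A, G.b x y = G.betaOut x :=
  (tsum_eq_sum fun _ hy => by_contra fun h => hy (mem_neighborhood hx (Or.inl h))).symm

theorem sum_neighborhood_in [DecidableEq V] {A : Finset V} {x : V} (hx : x ∈ A) :
    ∑ y ∈ G.neighborhood A, G.b y x = G.betaIn x :=
  (tsum_eq_sum fun _ hy => by_contra fun h => hy (mem_neighborhood hx (Or.inr h))).symm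

/-- A boundary edge of `U` has an end in `U ⊆ A`, so both ends lie in the neighbourhood of `A`.
Using `A` instead of `U` gives one summation range for all level sets in the co-area argument. -/
theorem boundaryWeight_eq_sum [DecidableEq V] {A U : Finset V} (hU : U ⊆ A) :
    G.boundaryWeight U = ((∑ x ∈ G.neighborhood A, ∑ y ∈ G.neighborhood A,
      if (x ∈ U ∧ y ∉ U) ∨ (x ∉ U ∧ y ∈ U) then G.b x y else 0 : ℝ≥0) : ℝ≥0∞) := by
  unfold boundaryWeight
  rw [tsum_subtype (G.edgeBoundary U) fun p : V × V => (G.b p.1 p.2 : ℝ≥0∞)]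
  have hterm : ∀ p : V × V, (G.edgeBoundary U).indicator
      (fun p : V × V => (G.b p.1 p.2 : ℝ≥0∞)) p =
        ((if (p.1 ∈ U ∧ p.2 ∉ U) ∨ (p.1 ∉ U ∧ p.2 ∈ U) then G.b p.1 p.2 else 0 : ℝ≥0) :
          ℝ≥0∞) := by
    intro p
    by_cases hp : (p.1 ∈ U ∧ p.2 ∉ U) ∨ (p.1 ∉ U ∧ p.2 ∈ U)
    · rw [if_pos hp]
      by_cases hb : G.b p.1 p.2 = 0
      · rw [hb]
        by_cases hmem : p ∈ G.edgeBoundary U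
        · rw [Set.indicator_of_mem hmem, hb]
        · rw [Set.indicator_of_notMem hmem, ENNReal.coe_zero]
      · exact Set.indicator_of_mem (s := G.edgeBoundary U) ⟨pos_iff_ne_zero.2 hb, hp⟩ _
    · rw [if_neg hp, ENNReal.coe_zero]
      exact Set.indicator_of_notMem (s := G.edgeBoundary U) (fun hmem => hp hmem.2) _
  rw [tsum_congr hterm, tsum_eq_sum (s := G.neighborhood A ×ˢ G.neighborhood A),
    Finset.sum_product]
  · push_cast
    rfl
  · intro p hp
    by_contra hne
    refine hp (Finset.mem_product.2 ?_)
    rw [ENNReal.coe_eq_zero, ite_eq_right_iff, Classical.not_imp] at hne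
    obtain ⟨h | h, hb⟩ := hne
    · exact ⟨subset_neighborhood A (hU h.1), mem_neighborhood (hU h.1) (Or.inl hb)⟩
    · exact ⟨mem_neighborhood (hU h.2) (Or.inr hb), subset_neighborhood A (hU h.2)⟩

/-- The isoperimetric inequality in `Ω`, written with real finite sums. -/
theorem mul_sum_betaOut_le [DecidableEq V] {Ω : Set V} {h : ℝ≥0}
    (hh : (h : ℝ≥0∞) ≤ G.normCheeger Ω) {A U : Finset V} (hA : (A : Set V) ⊆ Ω) (hU : U ⊆ A)
    (hne : U.Nonempty) :
    (h : ℝ) * ∑ x ∈ U, (G.betaOut x : ℝ) ≤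
      ∑ x ∈ G.neighborhood A, ∑ y ∈ G.neighborhood A,
        (G.b x y : ℝ) * |(if x ∈ U then 1 else 0) - (if y ∈ U then 1 else 0)| := by
  have h1 : (h : ℝ≥0∞) ≤ G.boundaryWeight U / ∑ x ∈ U, (G.betaOut x : ℝ≥0∞) :=
    hh.trans (iInf_le_of_le U (iInf_le_of_le hne
      (iInf_le_of_le ((Finset.coe_subset.2 hU).trans hA) le_rfl)))
  have h2 := ENNReal.mul_le_of_le_div h1
  rw [boundaryWeight_eq_sum hU] at h2
  have h3 : h * ∑ x ∈ U, G.betaOut x ≤ ∑ x ∈ G.neighborhood A, ∑ y ∈ G.neighborhood A,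
      if (x ∈ U ∧ y ∉ U) ∨ (x ∉ U ∧ y ∈ U) then G.b x y else 0 := by exact_mod_cast h2
  have h4 := NNReal.coe_le_coe.2 h3
  push_cast at h4
  refine h4.trans (le_of_eq ?_)
  refine Finset.sum_congr rfl fun x _ => Finset.sum_congr rfl fun y _ => ?_
  by_cases hx : x ∈ U <;> by_cases hy : y ∈ U <;> simp [hx, hy]

/-- The sesquilinear form of the Laplacian as a finite sum. -/
theorem inner_laplacian_eq_sum [DecidableEq V] (f : G.laplacian.domain) {A : Finset V}
    (hA : ∀ x, x ∉ A → G.fn f x = 0) :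
    inner ℂ (f : G.L2) (G.laplacian f) = ∑ x ∈ G.neighborhood A, ∑ y ∈ G.neighborhood A,
      (G.b x y : ℂ) * ((G.fn f x - G.fn f y) * conj (G.fn f x)) := by
  rw [L2_inner, tsum_eq_sum (s := G.neighborhood A)]
  · refine Finset.sum_congr rfl fun x _ => ?_
    by_cases hx : x ∈ A
    · have h1 : G.fn (G.laplacian f) x = 1 / (G.m x : ℂ) *
          ∑ y ∈ G.neighborhood A, (G.b x y : ℂ) * (G.fn f x - G.fn f y) := by
        change G.lapFn (G.fn f) x = _
        unfold lapFn
        rw [tsum_eq_sum]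
        intro y hy
        have : G.b x y = 0 := by_contra fun h => hy (mem_neighborhood hx (Or.inl h))
        simp [this]
      have hm : (G.m x : ℂ) ≠ 0 := by exact_mod_cast (G.m_pos x).ne'
      rw [h1, ← mul_assoc, ← mul_assoc, mul_one_div_cancel hm, one_mul, Finset.sum_mul]
      simp only [mul_assoc]
    · simp [hA x hx]
  · intro x hx
    simp [hA x fun h => hx (subset_neighborhood A h)]

theorem mul_le_betaOut {Ω : Set V} {C : ℝ≥0} (hC : (C : ℝ≥0∞) ≤ G.minRatio Ω) {x : V}
    (hx : x ∈ Ω) : C * G.m x ≤ G.betaOut x := by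
  have h1 : (C : ℝ≥0∞) ≤ (G.betaOut x : ℝ≥0∞) / (G.m x : ℝ≥0∞) :=
    hC.trans (iInf₂_le x hx)
  exact_mod_cast ENNReal.mul_le_of_le_div h1

/-- Cheeger's inequality for the Laplacian on finitely supported functions vanishing off `Ω`. -/
theorem cheeger_laplacian (hK : G.Kirchhoff) {Ω : Set V} {h C : ℝ≥0} (hpos : 0 < h)
    (hh : (h : ℝ≥0∞) ≤ G.normCheeger Ω) (hC : (C : ℝ≥0∞) ≤ G.minRatio Ω)
    (f : G.laplacian.domain) (hf : ∀ x, x ∉ Ω → G.fn f x = 0) :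
    (h : ℝ) ^ 2 / 8 * (C * ‖(f : G.L2)‖ ^ 2) ≤
      (inner ℂ (f : G.L2) (G.laplacian f)).re := by
  classical
  have hfin : (Function.support (G.fn f)).Finite := f.2
  let A : Finset V := hfin.toFinset
  have hmemA : ∀ x, x ∉ A → G.fn f x = 0 := fun x hx => by
    simpa [A] using hx
  have hAΩ : (A : Set V) ⊆ Ω := fun x hx => by
    by_contra hxΩ
    exact (hfin.mem_toFinset.1 (Finset.mem_coe.1 hx)) (hf x hxΩ)
  have hch := cheeger_inequality (G.neighborhood A) A (subset_neighborhood A)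
    (fun x y => (G.b x y : ℝ)) (fun x y => (G.b x y).2) (fun x => (G.betaOut x : ℝ))
    (h := h) (by exact_mod_cast hpos)
    (fun x hx => by exact_mod_cast sum_neighborhood_out (G := G) hx)
    (fun x hx => by rw [hK x]; exact_mod_cast sum_neighborhood_in (G := G) hx)
    (fun U hU hne => mul_sum_betaOut_le hh hAΩ hU hne) (G.fn f) hmemA
  have hre : (inner ℂ (f : G.L2) (G.laplacian f)).re = ∑ x ∈ G.neighborhood A,
      ∑ y ∈ G.neighborhood A, (G.b x y : ℝ) *
        ((G.fn f x - G.fn f y) * conj (G.fn f x)).re := by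
    rw [inner_laplacian_eq_sum f hmemA, Complex.re_sum]
    refine Finset.sum_congr rfl fun x _ => ?_
    rw [Complex.re_sum]
    exact Finset.sum_congr rfl fun y _ => Complex.re_ofReal_mul _ _
  rw [hre]
  -- What remains compares the norm weighted by `m` with the sum weighted by `β⁺`, pointwise through
  -- `C m ≤ β⁺`.
  refine le_trans (mul_le_mul_of_nonneg_left ?_ (by positivity)) hch
  rw [L2_norm_sq, tsum_eq_sum (s := A) fun x hx => by simp [hmemA x hx], Finset.mul_sum]
  refine Finset.sum_le_sum fun x hx => ?_
  rw [← mul_assoc]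
  refine mul_le_mul_of_nonneg_right ?_ (by positivity)
  exact_mod_cast mul_le_betaOut hC (hAΩ hx)

end DiWGraph

/-! ### Emptiness of the essential spectrum -/

theorem mainTheorem3 {V : Type*} [Countable V] [Infinite V] (G : DiWGraph V)
    (hconn : G.undirected.Connected)
    (hpos : ∀ x, 0 < G.betaOut x ∧ 0 < G.betaIn x)
    (hK : G.Kirchhoff)
    (F : G.Filtration) (hheavy : F.HeavyEnds) (hcheeger : 0 < F.normCheegerInfty) :
    G.laplacian.closure.essSpectrum = ∅ := by
  classical
  refine Set.eq_empty_iff_forall_notMem.2 fun z => ?_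
  obtain ⟨h, h0, hlt⟩ := ENNReal.lt_iff_exists_nnreal_btwn.1 hcheeger
  have h0' : 0 < h := by exact_mod_cast h0
  -- Chosen so that `(h²/8) C = |z| + 1`: `|z|` absorbs the shift by `z`, and `1` is left as the
  -- lower bound.
  let C : ℝ≥0 := (‖z‖₊ + 1) * 8 / h ^ 2
  have hm : Tendsto (fun n => G.minRatio ((F.verts n : Set V)ᶜ)) atTop (𝓝 ⊤) :=
    hheavy ▸ F.tendsto_minRatioInfty
  obtain ⟨n, hn1, hn2⟩ := ((F.tendsto_normCheegerInfty.eventually (lt_mem_nhds hlt)).and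
    (hm.eventually (lt_mem_nhds (ENNReal.coe_lt_top (r := C))))).exists
  refine LinearPMap.notMem_essSpectrum_closure G.laplacian_isClosable
    (ι := F.verts n) (fun x => G.dirac x) (fun x => G.coordCLM x)
    (fun x y => by simp only [DiWGraph.coordCLM_dirac, Subtype.ext_iff]) z fun f hf => ?_
  have hch := DiWGraph.cheeger_laplacian hK h0' hn1.le hn2.le f fun x hx =>
    hf ⟨x, by simpa using hx⟩
  have hC : (h : ℝ) ^ 2 / 8 * (C * ‖(f : G.L2)‖ ^ 2) = (‖z‖ + 1) * ‖(f : G.L2)‖ ^ 2 := by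
    have : (h : ℝ) ≠ 0 := by exact_mod_cast h0'.ne'
    simp only [C, NNReal.coe_div, NNReal.coe_mul, NNReal.coe_add, coe_nnnorm, NNReal.coe_one,
      NNReal.coe_pow, NNReal.coe_ofNat]
    field_simp
  rw [hC] at hch
  have h1 : (inner ℂ (f : G.L2) (G.laplacian f)).re =
      (inner ℂ (f : G.L2) (G.laplacian f - z • (f : G.L2))).re +
        (inner ℂ (f : G.L2) (z • (f : G.L2))).re := by
    rw [← Complex.add_re, ← inner_add_right, sub_add_cancel]
  have h2 : (inner ℂ (f : G.L2) (G.laplacian f - z • (f : G.L2))).re ≤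
      ‖(f : G.L2)‖ * ‖G.laplacian f - z • (f : G.L2)‖ :=
    (Complex.re_le_norm _).trans (norm_inner_le_norm _ _)
  have h3 : (inner ℂ (f : G.L2) (z • (f : G.L2))).re ≤ ‖(f : G.L2)‖ * (‖z‖ * ‖(f : G.L2)‖) := by
    rw [← norm_smul]
    exact (Complex.re_le_norm _).trans (norm_inner_le_norm _ _)
  rcases (norm_nonneg (f : G.L2)).eq_or_lt with hz | hz
  · rw [← hz]
    exact norm_nonneg _
  · refine le_of_mul_le_mul_left ?_ hz
    nlinarith
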